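/- Let $M$ be a finite matroid with ground set $E$, rank function $\rho$ and nullity $\eta(X)=|X|-\rho(X)$. A set $X\subseteq E$ is a flat if $\rho(X\cup\{e\})>\rho(X)$ for all $e\in E\setminus X$, it is cyclic if $\rho(X\setminus\{e\})=\rho(X)$ for all $e\in X$, and a cyclic flat is a set that is both. Let $\mathcal Z$ be the lattice of cyclic flats of $M$, ordered by inclusion, with least element $0_{\mathcal Z}=\{e\in E:\rho(\{e\})=0\}$ and greatest element $1_{\mathcal Z}=\{e\in E:\rho(E\setminus\{e\})=\rho(E)\}$. The matroid $M$ is binary if it is isomorphic to the matroid of the columns of a matrix over $\mathbb F_2$. The following three conditions are equivalent. (i) $M$ is binary. (ii) For every flat $F\subseteq 1_{\mathcal Z}$ with $\rho(F)=\rho(1_{\mathcal Z})-2$ it holds that $$|1_{\mathcal Z}\setminus F|-\sum_{X}\bigl(|X\setminus F|-1\bigr)<4,$$ where the sum is taken over those inclusion-maximal elements $X$ of $\{X\in\mathcal Z:\rho(1_{\mathcal Z})-1=\rho(X)+|F\setminus X|\}$ that are not contained in $F$. (iii) For every cyclic set $U\supseteq 0_{\mathcal Z}$ with $\eta(U)=|0_{\mathcal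 Z}|+2$ it holds that $$|U\setminus 0_{\mathcal Z}|-\sum_{X}\bigl(|U\setminus X|-1\bigr)<4,$$ where the sum is taken over those inclusion-minimal elements $X$ of $\{X\in\mathcal Z:|0_{\mathcal Z}|+1+\rho(X)=|X\cap U|\}$ that do not contain $U$. -/

import Mathlib

namespace CyclicFlats

variable {α : Type*}

/-- The rank `ρ(X)` in a finite matroid, as a natural number. -/
noncomputable def rk (M : Matroid α) (X : Set α) : ℕ := (M.eRk X).toNat

/-- The nullity `η(X) = |X| - ρ(X)`, as an integer. -/
noncomputable def nullity (M : Matroid α) (X : Set α) : ℤ := (X.ncard : ℤ) - (rk M X : ℤ)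

/-- The cyclic operator `cyc(X) = {e ∈ X : ρ(X - e) = ρ(X)}`. -/
def cyc (M : Matroid α) (X : Set α) : Set α := {e ∈ X | rk M (X \ {e}) = rk M X}

/-- A cyclic set: a set `X ⊆ E` with `cyc(X) = X`. -/
def IsCyclicSet (M : Matroid α) (X : Set α) : Prop := X ⊆ M.E ∧ cyc M X = X

/-- A cyclic flat: a flat which is a cyclic set. -/
def IsCyclicFlat (M : Matroid α) (Z : Set α) : Prop := M.IsFlat Z ∧ IsCyclicSet M Z

/-- The largest cyclic flat `1_𝒵 = cyc(E)`. -/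
def topZ (M : Matroid α) : Set α := cyc M M.E

/-- The smallest cyclic flat `0_𝒵 = cl(∅)`. -/
def botZ (M : Matroid α) : Set α := M.closure ∅

/-- `M` is representable over the field `K`: it is isomorphic to the matroid of the columns of a
matrix `G` over `K`, i.e. there is a bijection `ψ` from the columns of `G` to the ground set of `M`
under which the rank of every set `X` of columns of `G` is the rank of `ψ(X)` in `M`. -/
def IsRepresentable (K : Type*) [Field K] (M : Matroid α) : Prop :=
  ∃ (m n : ℕ) (G : Matrix (Fin m) (Fin n) K) (ψ : Fin n ≃ M.E), ∀ X : Finset (Fin n),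
    rk M ((fun j => (ψ j : α)) '' (X : Set (Fin n))) =
      (G.submatrix id (fun j : {j // j ∈ X} => (j : Fin n))).rank

/-- A binary matroid: one that is representable over the field with two elements. -/
def IsBinary (M : Matroid α) : Prop := IsRepresentable (ZMod 2) M

/-- The cyclic flats `X` with `ρ(1_𝒵) - 1 = ρ(X) + |F - X|`. -/
def upsilon (M : Matroid α) (F : Set α) : Set (Set α) :=
  {X | IsCyclicFlat M X ∧ (rk M (topZ M) : ℤ) - 1 = (rk M X : ℤ) + ((F \ X).ncard : ℤ)}

/-- The inclusion-maximal members of `upsilon M F` that are not contained in `F`. -/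
def upsilonMax (M : Matroid α) (F : Set α) : Set (Set α) :=
  {X | Maximal (fun Y => Y ∈ upsilon M F) X ∧ ¬ X ⊆ F}

/-- The cyclic flats `X` with `|0_𝒵| + 1 + ρ(X) = |X ∩ U|`. -/
def upsilonDual (M : Matroid α) (U : Set α) : Set (Set α) :=
  {X | IsCyclicFlat M X ∧ (botZ M).ncard + 1 + rk M X = (X ∩ U).ncard}

/-- The inclusion-minimal members of `upsilonDual M U` that do not contain `U`. -/
def upsilonDualMin (M : Matroid α) (U : Set α) : Set (Set α) :=
  {X | Minimal (fun Y => Y ∈ upsilonDual M U) X ∧ ¬ U ⊆ X}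

theorem rk_diff_singleton_iff (M : Matroid α) [M.Finite] {X : Set α} {e : α}
    (hX : X ⊆ M.E) (he : e ∈ X) :
    rk M (X \ {e}) = rk M X ↔ e ∈ M.closure (X \ {e}) := by
  have h1 : M.IsRkFinite (X \ {e}) := M.isRkFinite_of_finite (M.ground_finite.subset
    (Set.sdiff_subset.trans hX))
  have h2 : M.IsRkFinite X := M.isRkFinite_of_finite (M.ground_finite.subset hX)
  unfold rk
  have h3 : (M.eRk (X \ {e})).toNat = (M.eRk X).toNat ↔ M.eRk (X \ {e}) = M.eRk X := by
    rw [← ENat.natCast_inj, ENat.natCast_toNat (Matroid.eRk_ne_top_iff.2 h1),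
      ENat.natCast_toNat (Matroid.eRk_ne_top_iff.2 h2)]
  rw [h3]
  constructor
  · intro h
    have := h1.closure_eq_closure_of_subset_of_eRk_ge_eRk Set.sdiff_subset h.ge
    rw [this]
    exact M.mem_closure_of_mem he hX
  · intro h
    conv_rhs => rw [← Set.insert_sdiff_self_of_mem he, ← M.eRk_closure_eq,
      Matroid.closure_insert_eq_of_mem_closure h, M.eRk_closure_eq]

theorem isCyclicSet_iff (M : Matroid α) [M.Finite] {X : Set α} :
    IsCyclicSet M X ↔ X ⊆ M.E ∧ ∀ e ∈ X, e ∈ M.closure (X \ {e}) := by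
  unfold IsCyclicSet cyc
  constructor
  · rintro ⟨h, h'⟩
    refine ⟨h, fun e he => ?_⟩
    have h2 := he
    rw [← h'] at h2
    exact (rk_diff_singleton_iff M h he).1 h2.2
  · rintro ⟨h, h'⟩
    exact ⟨h, Set.Subset.antisymm (fun e he => he.1)
      (fun e he => ⟨he, (rk_diff_singleton_iff M h he).2 (h' e he)⟩)⟩

theorem topZ_eq (M : Matroid α) [M.Finite] : topZ M = M.E \ M.coloops := by
  ext e
  constructor
  · rintro ⟨he, h⟩
    refine ⟨he, fun hc => ?_⟩
    exact (M.isColoop_iff_notMem_closure_compl he).1 hc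
      ((rk_diff_singleton_iff M subset_rfl he).1 h)
  · rintro ⟨he, h⟩
    refine ⟨he, (rk_diff_singleton_iff M subset_rfl he).2 ?_⟩
    by_contra hc
    exact h ((M.isColoop_iff_notMem_closure_compl he).2 hc)

/-- `1_𝒵` is the top element of the lattice of cyclic flats. -/
theorem isGreatest_topZ (M : Matroid α) [M.Finite] :
    IsGreatest {Z | IsCyclicFlat M Z} (topZ M) := by
  constructor
  · rw [topZ_eq]
    refine ⟨?_, (isCyclicSet_iff M).2 ⟨Set.sdiff_subset, ?_⟩⟩
    · rw [Matroid.isFlat_iff_closure_eq]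
      refine Set.Subset.antisymm (fun e he => ⟨M.closure_subset_ground _ he, fun hc => ?_⟩)
        (M.subset_closure _ Set.sdiff_subset)
      exact Matroid.IsColoop.notMem_closure_of_notMem (M := M) hc (fun h => h.2 hc) he
    · rintro e ⟨he, hc⟩
      obtain ⟨C, hC, heC⟩ := M.exists_mem_isCircuit_of_not_isColoop he hc
      refine M.closure_subset_closure ?_ (hC.mem_closure_sdiff_singleton_of_mem heC)
      exact Set.sdiff_subset_sdiff_left
        (fun x hx => ⟨hC.subset_ground hx, hC.not_isColoop_of_mem hx⟩)
  · intro Z hZ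
    have h := (isCyclicSet_iff M).1 hZ.2
    refine fun e he => ⟨h.1 he, (rk_diff_singleton_iff M subset_rfl (h.1 he)).2 ?_⟩
    exact M.closure_subset_closure (Set.sdiff_subset_sdiff_left h.1) (h.2 e he)

/-- `0_𝒵` is the bottom element of the lattice of cyclic flats. -/
theorem isLeast_botZ (M : Matroid α) [M.Finite] :
    IsLeast {Z | IsCyclicFlat M Z} (botZ M) := by
  refine ⟨⟨M.isFlat_closure ∅, (isCyclicSet_iff M).2 ⟨M.closure_subset_ground _, ?_⟩⟩, ?_⟩
  · exact fun e he => M.closure_subset_closure (Set.empty_subset _) he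
  · intro Z hZ
    have h := M.closure_subset_closure (Set.empty_subset Z)
    rwa [hZ.1.closure] at h

end CyclicFlats

open CyclicFlats

/-!
All three conditions say that `M` has no minor isomorphic to the four-point line `U_{2,4}`. This is
stated here through bases (`HasFourPointLine`): no set `I` is completed to a base by every pair out
of four elements. In this form the property is visibly self-dual (`hasFourPointLine_dual_iff`): replace
`I` by the complement of `I ∪ {a, b, c, d}`.

That binary matroids are the ones without a four-point line is Tutte's theorem
(`isBinary_iff_not_hasFourPointLine`). One direction holds because a space of dimension two over the
two-element field has only three nonzero vectors. For the other, give the elements of a base `B` the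
standard basis vectors, and every other element the sum over the rest of its fundamental circuit. In
the absence of a four-point line, a base exchange changes fundamental circuits by symmetric
difference (`fundCircuit_exchange`), so the fundamental circuits of every base still sum to zero
(`finsum_fundCircuit_eq_zero`). Every circuit is fundamental for some base, so all circuits sum to
zero. Hence dependent sets are linearly dependent, every base spans, and, by comparing sizes, every
base is linearly independent.

In the condition on flats, the expression compared with `4` is the number of hyperplanes of
`M ↾ 1_𝒵` that contain `F` (`ncard_sdiff_sub_finsum_upsilonMax`). These hyperplanes partition
`1_𝒵 \ F`, and so the number is `|1_𝒵 \ F|` minus the sum of `|H \ F| - 1` over those `H` with at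
least two elements outside `F`. Such an `H` corresponds to its cyclic part `X`, which satisfies
`X \ F = H \ F`, and these cyclic parts are exactly the sets in the sum
(`upsilonMax_eq_image_cyc`). Choosing one element from each of four hyperplanes above `F` gives a
four-point line on a basis of `F` together with the coloops, and conversely.

The condition on cyclic sets for `M` is the condition on flats for the dual matroid, by taking
complements in the ground set (`forall_cyclicSet_lt_four_iff`).
-/

namespace CyclicFlats

open Set Module
open scoped symmDiff

variable {α : Type*}

/-! ### Four-point lines -/

/-- `x` and `y` are distinct elements outside `I` that complete `I` to a base; equivalently, `I` is
independent of corank two and `x`, `y` form a base of the contraction `M ／ I`. -/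
def IsBasePair (M : Matroid α) (I : Set α) (x y : α) : Prop :=
  x ≠ y ∧ x ∉ I ∧ y ∉ I ∧ M.IsBase (insert x (insert y I))

/-- `M` has a minor isomorphic to the four-point line `U_{2,4}`, expressed through bases: some set
`I` is completed to a base by every pair from four elements `a, b, c, d`. -/
def HasFourPointLine (M : Matroid α) : Prop :=
  ∃ (I : Set α) (a b c d : α), IsBasePair M I a b ∧ IsBasePair M I a c ∧ IsBasePair M I a d ∧
    IsBasePair M I b c ∧ IsBasePair M I b d ∧ IsBasePair M I c d

theorem IsBasePair.symm {M : Matroid α} {I : Set α} {x y : α} (h : IsBasePair M I x y) :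
    IsBasePair M I y x :=
  ⟨h.1.symm, h.2.2.1, h.2.1, by rw [insert_comm]; exact h.2.2.2⟩

/-- Base exchange in the rank-two contraction `M ／ I`: a nonloop `z` is parallel to at most one
element of a base `{x, y}`. -/
theorem IsBasePair.exchange {M : Matroid α} {I : Set α} {x y z w : α} (hxy : IsBasePair M I x y)
    (hzw : IsBasePair M I z w) : IsBasePair M I x z ∨ IsBasePair M I y z := by
  obtain ⟨hne, hx, hy, hB⟩ := hxy
  obtain ⟨hne', hz, hw, hB'⟩ := hzw
  have hwz : w ∉ insert z I := fun h => h.elim (fun h => hne' h.symm) hw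
  have hBw : M.IsBase (insert w (insert z I)) := by rwa [insert_comm]
  have hind : M.Indep (insert z I) := hBw.indep.subset (subset_insert _ _)
  have hnb : ¬ M.IsBase (insert z I) :=
    fun h => hwz (h.mem_of_insert_indep hBw.indep)
  obtain ⟨e, ⟨heB, hez⟩, he⟩ := hind.exists_insert_of_not_isBase hnb hB
  have heB' := Matroid.insert_isBase_of_insert_indep hwz hez hBw he
  rcases heB with rfl | rfl | heI
  · exact Or.inl ⟨fun h => hez (h ▸ mem_insert _ _), hx, hz, heB'⟩
  · exact Or.inr ⟨fun h => hez (h ▸ mem_insert _ _), hy, hz, heB'⟩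
  · exact absurd (mem_insert_of_mem _ heI) hez

theorem HasFourPointLine.dual {M : Matroid α} (h : HasFourPointLine M) : HasFourPointLine M✶ := by
  obtain ⟨I, a, b, c, d, hab, hac, had, hbc, hbd, hcd⟩ := h
  -- If `p, q` complete `I` to a base, then the complement of that base consists of `r`, `s` and the
  -- complement of `I ∪ {p, q, r, s}`.
  have key : ∀ {p q r s : α}, IsBasePair M I p q → IsBasePair M I r s → p ≠ r → p ≠ s → q ≠ r →
      q ≠ s → IsBasePair M✶ (M.E \ (I ∪ {p, q, r, s})) r s := by
    intro p q r s hpq hrs h1 h2 h3 h4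
    obtain ⟨hne, hp, hq, hB⟩ := hpq
    obtain ⟨hne', hr, hs, hB'⟩ := hrs
    refine ⟨hne', fun h => h.2 (by simp), fun h => h.2 (by simp), ?_⟩
    have hE := hB.subset_ground
    have hE' := hB'.subset_ground
    have hsub : insert r (insert s (M.E \ (I ∪ {p, q, r, s}))) =
        M.E \ (insert p (insert q I)) := by
      have hrE : r ∈ M.E := hE' (by simp)
      have hsE : s ∈ M.E := hE' (by simp)
      ext x
      simp only [mem_insert_iff, mem_sdiff, mem_union, mem_singleton_iff]
      by_cases hxr : x = r
      · subst hxr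
        simp [hrE, hr, Ne.symm h1, Ne.symm h3]
      by_cases hxs : x = s
      · subst hxs
        simp [hsE, hs, Ne.symm h2, Ne.symm h4]
      simp only [hxr, hxs, or_false, false_or]
      tauto
    rw [hsub]
    exact hB.compl_isBase_dual
  have h1 : ∀ p q r s : α, ({p, q, r, s} : Set α) = {a, b, c, d} →
      M.E \ (I ∪ {p, q, r, s}) = M.E \ (I ∪ {a, b, c, d}) := fun p q r s h => by rw [h]
  refine ⟨M.E \ (I ∪ {a, b, c, d}), a, b, c, d, ?_, ?_, ?_, ?_, ?_, ?_⟩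
  · rw [← h1 c d a b (by grind)]
    exact key hcd hab hac.1.symm hbc.1.symm had.1.symm hbd.1.symm
  · rw [← h1 b d a c (by grind)]
    exact key hbd hac hab.1.symm hbc.1 had.1.symm hcd.1.symm
  · rw [← h1 b c a d (by grind)]
    exact key hbc had hab.1.symm hbd.1 hac.1.symm hcd.1
  · rw [← h1 a d b c (by grind)]
    exact key had hbc hab.1 hac.1 hbd.1.symm hcd.1.symm
  · rw [← h1 a c b d (by grind)]
    exact key hac hbd hab.1 had.1 hbc.1.symm hcd.1
  · exact key hab hcd hac.1 had.1 hbc.1 hbd.1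

theorem hasFourPointLine_dual_iff {M : Matroid α} :
    HasFourPointLine M✶ ↔ HasFourPointLine M :=
  ⟨fun h => by simpa using h.dual, HasFourPointLine.dual⟩

/-! ### Fundamental circuits without a four-point line -/

theorem mem_fundCircuit_iff_isBase {M : Matroid α} {B : Set α} {e x : α} (hB : M.IsBase B)
    (heE : e ∈ M.E) (heB : e ∉ B) (hx : x ∈ B) :
    x ∈ M.fundCircuit e B ↔ M.IsBase (insert e (B \ {x})) := by
  rw [hB.indep.mem_fundCircuit_iff (by rwa [hB.closure_eq]) heB,
    insert_sdiff_of_notMem _ (by rintro rfl; exact heB hx)]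
  refine ⟨fun h => ?_, fun h => h.indep⟩
  have hne : e ∉ ({x} : Set α) := by rintro rfl; exact heB hx
  rw [← insert_sdiff_of_notMem _ hne] at h ⊢
  exact hB.exchange_isBase_of_indep' hx heB h

/-- After removing `b` and `b'` from a base, membership of `b` in the fundamental circuit of `e`
says that `e` and `b'` are independent in the resulting rank-two contraction. -/
theorem mem_fundCircuit_iff_isBasePair {M : Matroid α} {B : Set α} {e b b' : α} (hB : M.IsBase B)
    (heE : e ∈ M.E) (heB : e ∉ B) (hb : b ∈ B) (hb' : b' ∈ B) (hne : b ≠ b') :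
    b ∈ M.fundCircuit e B ↔ IsBasePair M (B \ {b, b'}) e b' := by
  have h : insert e (insert b' (B \ {b, b'})) = insert e (B \ {b}) := by
    congr 1; ext x; simp only [mem_insert_iff, mem_sdiff, mem_singleton_iff]
    by_cases hx : x = b'
    · subst hx; simp [hb', hne.symm]
    · simp [hx]
  rw [mem_fundCircuit_iff_isBase hB heE heB hb, IsBasePair, h]
  exact ⟨fun h => ⟨by rintro rfl; exact heB hb', fun h' => heB h'.1, by simp, h⟩,
    fun h => h.2.2.2⟩

/-- Pivoting: if `M` has no four-point line, then fundamental circuits through the leaving element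
change by symmetric difference, as they do over the two-element field. -/
theorem fundCircuit_exchange {M : Matroid α} (hM : ¬ HasFourPointLine M) {B : Set α} {b e f : α}
    (hB : M.IsBase B) (hb : b ∈ B) (heE : e ∈ M.E) (heB : e ∉ B) (hfE : f ∈ M.E) (hfB : f ∉ B)
    (hef : e ≠ f) (hbe : b ∈ M.fundCircuit e B) (hbf : b ∈ M.fundCircuit f B) :
    M.fundCircuit f (insert e (B \ {b})) = M.fundCircuit e B ∆ M.fundCircuit f B := by
  have hB₁ := (mem_fundCircuit_iff_isBase hB heE heB hb).1 hbe
  have hbe' : b ≠ e := by rintro rfl; exact heB hb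
  have hbf' : b ≠ f := by rintro rfl; exact hfB hb
  have hfB₁ : f ∉ insert e (B \ {b}) := by
    simp only [mem_insert_iff, mem_sdiff, mem_singleton_iff]; tauto
  have hsub : ∀ x g, x ∈ M.fundCircuit g B → x = g ∨ x ∈ B :=
    fun x g hx => M.fundCircuit_subset_insert g B hx
  have heCf : e ∉ M.fundCircuit f B := fun h => (hsub _ _ h).elim hef heB
  have hfCe : f ∉ M.fundCircuit e B := fun h => (hsub _ _ h).elim hef.symm hfB
  ext x
  rw [mem_symmDiff]
  by_cases hxf : x = f
  · subst hxf
    simp [M.mem_fundCircuit, hfCe]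
  by_cases hxe : x = e
  · subst hxe
    simp only [M.mem_fundCircuit, heCf, not_false_eq_true, and_self, true_or, iff_true]
    rw [mem_fundCircuit_iff_isBase hB₁ hfE hfB₁ (mem_insert _ _),
      insert_sdiff_of_mem _ (mem_singleton _), sdiff_singleton_eq_self (fun h => heB h.1)]
    exact (mem_fundCircuit_iff_isBase hB hfE hfB hb).1 hbf
  by_cases hxb : x = b
  · subst hxb
    simp only [hbe, hbf, not_true, and_false, or_false, iff_false]
    intro h
    rcases M.fundCircuit_subset_insert _ _ h with h | h | h
    · exact hxf h
    · exact hxe h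
    · exact h.2 rfl
  by_cases hxB : x ∈ B
  swap
  · have h1 : x ∉ M.fundCircuit e B := fun h => (hsub _ _ h).elim hxe hxB
    have h2 : x ∉ M.fundCircuit f B := fun h => (hsub _ _ h).elim hxf hxB
    simp only [h1, h2, false_and, or_self, iff_false]
    intro h
    rcases M.fundCircuit_subset_insert _ _ h with h | h | h
    · exact hxf h
    · exact hxe h
    · exact hxB h.1
  -- The remaining elements are settled in the contraction of `B \ {b, x}`, where `b`, `x`, `e`, `f`
  -- would form a four-point line if `x` lay in both fundamental circuits and in the new one.
  have hI : B \ {x, b} = B \ {b, x} := by rw [pair_comm]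
  have hbB : IsBasePair M (B \ {b, x}) b x := by
    refine ⟨Ne.symm hxb, by simp, by simp, ?_⟩
    have : insert b (insert x (B \ {b, x})) = B := by
      ext y; simp only [mem_insert_iff, mem_sdiff, mem_singleton_iff]
      by_cases h1 : y = b
      · simp [h1, hb]
      by_cases h2 : y = x
      · simp [h2, hxB]
      simp [h1, h2]
    rwa [this]
  have hex := (mem_fundCircuit_iff_isBasePair hB heE heB hb hxB (Ne.symm hxb)).1 hbe
  have hfx := (mem_fundCircuit_iff_isBasePair hB hfE hfB hb hxB (Ne.symm hxb)).1 hbf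
  have heb := mem_fundCircuit_iff_isBasePair hB heE heB hxB hb hxb
  have hfb := mem_fundCircuit_iff_isBasePair hB hfE hfB hxB hb hxb
  rw [hI] at heb hfb
  have hfe : x ∈ M.fundCircuit f (insert e (B \ {b})) ↔ IsBasePair M (B \ {b, x}) f e := by
    have : insert e (B \ {b}) \ {x} = insert e (B \ {b, x}) := by
      rw [insert_sdiff_of_notMem _ (fun h => hxe (mem_singleton_iff.1 h).symm), sdiff_sdiff,
        singleton_union]
    rw [mem_fundCircuit_iff_isBase hB₁ hfE hfB₁ (mem_insert_of_mem _ ⟨hxB, hxb⟩), this, IsBasePair]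
    exact ⟨fun h => ⟨hef.symm, fun h => hfB h.1, fun h => heB h.1, h⟩, fun h => h.2.2.2⟩
  rw [hfe, heb, hfb]
  by_cases he : IsBasePair M (B \ {b, x}) e b <;> by_cases hf : IsBasePair M (B \ {b, x}) f b
  · simp only [he, hf, not_true, and_false, or_self, iff_false]
    exact fun h => hM ⟨_, b, x, e, f, hbB, he.symm, hf.symm, hex.symm, hfx.symm, h.symm⟩
  · simp only [he, hf, not_false_eq_true, and_self, true_or, iff_true]
    rcases he.exchange hfx with h | h
    · exact h.symm
    · exact absurd h.symm hf
  · simp only [he, hf, not_false_eq_true, and_self, or_true, iff_true]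
    rcases hf.exchange hex with h | h
    · exact h
    · exact absurd h.symm he
  · simp only [he, hf, false_and, or_self, iff_false]
    intro h
    rcases h.exchange hbB with h | h
    · exact hf h
    · exact he h

/-! ### Binary representations from fundamental circuits -/

section CircuitSums

variable {V : Type*} [AddCommGroup V] [Module (ZMod 2) V]

theorem finsum_mem_symmDiff_of_zmod_two (v : α → V) {C D : Set α} (hC : C.Finite) (hD : D.Finite) :
    ∑ᶠ x ∈ C ∆ D, v x = ∑ᶠ x ∈ C, v x + ∑ᶠ x ∈ D, v x := by
  have h1 : ∑ᶠ x ∈ C, v x = ∑ᶠ x ∈ C ∩ D, v x + ∑ᶠ x ∈ C \ D, v x :=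
    (finsum_mem_inter_add_sdiff D hC).symm
  have h2 : ∑ᶠ x ∈ D, v x = ∑ᶠ x ∈ C ∩ D, v x + ∑ᶠ x ∈ D \ C, v x := by
    rw [inter_comm]; exact (finsum_mem_inter_add_sdiff C hD).symm
  have h3 : ∑ᶠ x ∈ C ∆ D, v x = ∑ᶠ x ∈ C \ D, v x + ∑ᶠ x ∈ D \ C, v x :=
    finsum_mem_union (disjoint_left.2 fun x hx hx' => hx'.2 hx.1) (hC.sdiff) (hD.sdiff)
  rw [h1, h2, h3, add_add_add_comm, ZModModule.add_self, zero_add]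

/-- If `M` has no four-point line and the vectors on every fundamental circuit of the base `B` sum
to zero, then the same holds for every other base `B'`: the property survives each base exchange. -/
theorem finsum_fundCircuit_eq_zero {M : Matroid α} [M.Finite] (hM : ¬ HasFourPointLine M)
    (v : α → V) {B B' : Set α} (hB : M.IsBase B) (hB' : M.IsBase B')
    (h : ∀ e ∈ M.E \ B, ∑ᶠ x ∈ M.fundCircuit e B, v x = 0) :
    ∀ e ∈ M.E \ B', ∑ᶠ x ∈ M.fundCircuit e B', v x = 0 := by
  induction hn : (B \ B').ncard generalizing B with
  | zero =>
    rw [ncard_eq_zero (hB.finite.sdiff), sdiff_eq_empty] at hn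
    rwa [hB.eq_of_subset_isBase hB' hn] at h
  | succ n ih =>
    obtain ⟨b, hb⟩ : (B \ B').Nonempty := by
      rw [← ncard_pos (hB.finite.sdiff)]; omega
    obtain ⟨e, ⟨heB', heB⟩, hB₁⟩ := hB.exchange hB' hb
    have heE : e ∈ M.E := hB'.subset_ground heB'
    refine ih hB₁ ?_ ?_
    · have hbe := (mem_fundCircuit_iff_isBase hB heE heB hb.1).2 hB₁
      rintro f ⟨hfE, hfB₁⟩
      simp only [mem_insert_iff, mem_sdiff, mem_singleton_iff, not_or, not_and, not_not] at hfB₁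
      have hfin : ∀ g ∈ M.E, (M.fundCircuit g B).Finite := fun g hg =>
        M.ground_finite.subset (M.fundCircuit_subset_ground hg hB.subset_ground)
      have hCsub : ∀ g, b ∉ M.fundCircuit g B →
          M.fundCircuit g B ⊆ insert g (insert e (B \ {b})) := by
        intro g hg x hx
        rcases M.fundCircuit_subset_insert _ _ hx with rfl | hxB
        · exact mem_insert _ _
        · exact mem_insert_of_mem _ (mem_insert_of_mem _ ⟨hxB, by rintro rfl; exact hg hx⟩)
      by_cases hfb : f = b
      · subst hfb
        -- The fundamental circuit of the leaving element is that of the entering one.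
        have hC := hB.fundCircuit_isCircuit heE heB
        have heq := hC.eq_fundCircuit_of_subset (e := f) hB₁.indep (by
          intro x hx
          rcases M.fundCircuit_subset_insert _ _ hx with rfl | hxB
          · simp
          · by_cases hxf : x = f
            · simp [hxf]
            · simp [hxf, hxB])
        rw [← heq]
        exact h e ⟨heE, heB⟩
      have hfB : f ∉ B := fun hf => hfb (hfB₁.2 hf)
      by_cases hbf : b ∈ M.fundCircuit f B
      · rw [fundCircuit_exchange hM hB hb.1 heE heB hfE hfB (fun h => hfB₁.1 h.symm) hbe hbf,
          finsum_mem_symmDiff_of_zmod_two v (hfin e heE) (hfin f hfE), h e ⟨heE, heB⟩,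
          h f ⟨hfE, hfB⟩, add_zero]
      · rw [← (hB.fundCircuit_isCircuit hfE hfB).eq_fundCircuit_of_subset hB₁.indep (hCsub f hbf)]
        exact h f ⟨hfE, hfB⟩
    · have : insert e (B \ {b}) \ B' = (B \ B') \ {b} := by
        ext x; simp only [mem_insert_iff, mem_sdiff, mem_singleton_iff]
        by_cases hx : x = e
        · simp [hx, heB']
        · simp only [hx, false_or]; tauto
      rw [this, ncard_sdiff_singleton_of_mem hb, hn]
      simp

/-- A family that vanishes in sum on every circuit and is linearly independent on one base
represents `M` over the two-element field. -/
theorem indep_iff_linearIndepOn_of_finsum_isCircuit {M : Matroid α} [M.Finite] (v : α → V)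
    {B : Set α} (hB : M.IsBase B) (hv : LinearIndepOn (ZMod 2) v B)
    (h : ∀ C, M.IsCircuit C → ∑ᶠ x ∈ C, v x = 0) {I : Set α} (hI : I ⊆ M.E) :
    M.Indep I ↔ LinearIndepOn (ZMod 2) v I := by
  constructor
  · intro hind
    obtain ⟨B', hB', hIB'⟩ := hind.exists_isBase_superset
    refine LinearIndepOn.mono ?_ hIB'
    have hspan : Submodule.span (ZMod 2) (v '' M.E) = Submodule.span (ZMod 2) (v '' B') := by
      refine le_antisymm (Submodule.span_le.2 ?_)
        (Submodule.span_mono (image_mono hB'.subset_ground))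
      rintro _ ⟨e, he, rfl⟩
      by_cases heB' : e ∈ B'
      · exact Submodule.subset_span ⟨e, heB', rfl⟩
      have hC := hB'.fundCircuit_isCircuit he heB'
      have hfin := M.ground_finite.subset hC.subset_ground
      have hsum := h _ hC
      rw [← insert_sdiff_self_of_mem (M.mem_fundCircuit e B'),
        finsum_mem_insert _ (by simp) hfin.sdiff, add_eq_zero_iff_eq_neg] at hsum
      rw [SetLike.mem_coe, hsum]
      refine Submodule.neg_mem _ (finsum_mem_induction (· ∈ Submodule.span (ZMod 2) (v '' B'))
        (Submodule.zero_mem _) (fun _ _ => Submodule.add_mem _) fun x hx => ?_)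
      exact Submodule.subset_span
        ⟨x, (M.fundCircuit_subset_insert _ _ hx.1).resolve_left hx.2, rfl⟩
    have := hB.finite.fintype
    have := hB'.finite.fintype
    have : FiniteDimensional (ZMod 2) (Submodule.span (ZMod 2) (v '' B')) :=
      FiniteDimensional.span_of_finite _ (hB'.finite.image v)
    refine linearIndependent_iff_card_le_finrank_span.2 ?_
    have hcard := linearIndependent_iff_card_eq_finrank_span.1 hv
    rw [← Nat.card_eq_fintype_card, Nat.card_coe_set_eq] at hcard ⊢
    rw [hB'.ncard_eq_ncard_of_isBase hB, hcard, Set.finrank, Set.finrank,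
      ← image_eq_range, ← image_eq_range]
    refine Submodule.finrank_mono ?_
    rw [← hspan]
    exact Submodule.span_mono (image_mono hB.subset_ground)
  · intro hlin
    by_contra hnot
    obtain ⟨C, hCI, hC⟩ := ((M.not_indep_iff hI).1 hnot).exists_isCircuit_subset
    have hfin := M.ground_finite.subset hC.subset_ground
    have hCl := hlin.mono hCI
    rw [← hfin.coe_toFinset, linearIndepOn_finset_iff] at hCl
    obtain ⟨x, hx⟩ := hC.nonempty
    refine one_ne_zero (hCl (fun _ => 1) ?_ x (by simpa using hx))
    simp only [one_smul]
    rw [← finsum_mem_eq_finite_toFinset_sum]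
    exact h C hC

end CircuitSums

/-- The family `v` represents `M` over `K`: the independent sets are exactly the subsets of the
ground set on which `v` is linearly independent. The family is indexed by the whole ambient type,
and its values off the ground set play no role. -/
def IsVectorRep (K : Type*) [Field K] (M : Matroid α) {m : ℕ} (v : α → Fin m → K) : Prop :=
  ∀ I ⊆ M.E, M.Indep I ↔ LinearIndepOn K v I

theorem exists_isVectorRep_of_not_hasFourPointLine {M : Matroid α} [M.Finite]
    (hM : ¬ HasFourPointLine M) : ∃ (m : ℕ) (v : α → Fin m → ZMod 2), IsVectorRep (ZMod 2) M v := by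
  classical
  obtain ⟨B, hB⟩ := M.exists_isBase
  have := hB.finite.to_subtype
  obtain ⟨m, ⟨φ⟩⟩ := Finite.exists_equiv_fin B
  -- The base carries the standard basis; every other element is the sum over the rest of its
  -- fundamental circuit.
  let w : α → Fin m → ZMod 2 := fun x => if hx : x ∈ B then Pi.single (φ ⟨x, hx⟩) 1 else 0
  let v : α → Fin m → ZMod 2 := fun x =>
    if x ∈ B then w x else ∑ᶠ y ∈ M.fundCircuit x B \ {x}, w y
  have hvB : ∀ x ∈ B, v x = w x := fun x hx => if_pos hx
  have hw : LinearIndepOn (ZMod 2) w B := by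
    have h := (Pi.linearIndependent_single_one (Fin m) (ZMod 2)).comp φ φ.injective
    refine (linearIndependent_equiv' (Equiv.refl B) ?_).1 h
    ext x i
    simp [w]
  have hv : LinearIndepOn (ZMod 2) v B := (linearIndepOn_congr (fun x hx => hvB x hx)).2 hw
  refine ⟨m, v, fun I hI => indep_iff_linearIndepOn_of_finsum_isCircuit v hB hv ?_ hI⟩
  intro C hC
  obtain ⟨e, he⟩ := hC.nonempty
  obtain ⟨B', hB', hCB'⟩ := (hC.sdiff_singleton_indep he).exists_isBase_superset
  have hsub : C ⊆ insert e B' := fun x hx => by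
    by_cases hxe : x = e
    · exact Or.inl hxe
    · exact Or.inr (hCB' ⟨hx, hxe⟩)
  have heB' : e ∉ B' := fun h =>
    hC.not_indep (hB'.indep.subset (by rwa [insert_eq_of_mem h] at hsub))
  rw [hC.eq_fundCircuit_of_subset hB'.indep hsub]
  refine finsum_fundCircuit_eq_zero hM v hB hB' ?_ e ⟨hC.subset_ground he, heB'⟩
  rintro f ⟨hfE, hfB⟩
  have hfin := M.ground_finite.subset (M.fundCircuit_subset_ground hfE hB.subset_ground)
  rw [← insert_sdiff_self_of_mem (M.mem_fundCircuit f B), finsum_mem_insert _ (by simp) hfin.sdiff,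
    finsum_mem_congr rfl
      (fun x hx => hvB x ((M.fundCircuit_subset_insert _ _ hx.1).resolve_left hx.2))]
  simp only [v, if_neg hfB]
  exact ZModModule.add_self _

/-- Over the two-element field a space of dimension two has only three nonzero vectors, too few for
four pairwise independent ones. -/
theorem IsVectorRep.not_hasFourPointLine {M : Matroid α} {m : ℕ} {v : α → Fin m → ZMod 2}
    (hv : IsVectorRep (ZMod 2) M v) : ¬ HasFourPointLine M := by
  rintro ⟨I, a, b, c, d, hab, hac, had, hbc, hbd, hcd⟩
  set S := Submodule.span (ZMod 2) (v '' I) with hS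
  have hnot : ∀ {x y}, IsBasePair M I x y → v x ∉ S ∧ v x + v y ∉ S := by
    rintro x y ⟨hne, hx, hy, hB⟩
    have hlin := (hv _ hB.subset_ground).1 hB.indep
    rw [linearIndepOn_insert (by simp [hne, hx]), image_insert_eq] at hlin
    refine ⟨fun h => hlin.2 (Submodule.span_mono (subset_insert _ _) h), fun h => hlin.2 ?_⟩
    have := Submodule.sub_mem _ (Submodule.span_mono (subset_insert (v y) _) h)
      (Submodule.subset_span (mem_insert (v y) (v '' I)))
    simpa using this
  -- An element outside `{a, b}` must be congruent to `v a + v b` modulo the span of `I`.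
  have hsum : ∀ x, IsBasePair M I a x → IsBasePair M I b x → v x + (v a + v b) ∈ S := by
    intro x hax hbx
    have hxE : x ∈ M.E := hax.2.2.2.subset_ground (by simp)
    have hdep : v x ∈ Submodule.span (ZMod 2) (v '' (insert a (insert b I))) := by
      have hlin := (hv _ hab.2.2.2.subset_ground).1 hab.2.2.2.indep
      by_contra hcon
      have := (hlin.notMem_span_iff).1 hcon
      have hind := (hv _ (insert_subset hxE hab.2.2.2.subset_ground)).2 this.1
      exact this.2 (hab.2.2.2.mem_of_insert_indep hind)
    rw [image_insert_eq, image_insert_eq, Submodule.mem_span_insert] at hdep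
    obtain ⟨p, z, hz, hxz⟩ := hdep
    rw [Submodule.mem_span_insert] at hz
    obtain ⟨q, s, hs, rfl⟩ := hz
    have h2 : ∀ y : Fin m → ZMod 2, y + y = 0 := ZModModule.add_self
    have h01 : ∀ p : ZMod 2, p = 0 ∨ p = 1 := by decide
    rcases h01 p with rfl | rfl <;> rcases h01 q with rfl | rfl
    · simp only [zero_smul, zero_add] at hxz
      exact absurd (hxz ▸ hs) (hnot hax.symm).1
    · simp only [zero_smul, zero_add, one_smul] at hxz
      refine absurd ?_ (hnot hbx).2
      rwa [hxz, ← add_assoc, h2, zero_add]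
    · simp only [zero_smul, zero_add, one_smul] at hxz
      refine absurd ?_ (hnot hax).2
      rwa [hxz, ← add_assoc, h2, zero_add]
    · simp only [one_smul] at hxz
      have : v x + (v a + v b) = s + ((v a + v a) + (v b + v b)) := by rw [hxz]; abel
      rw [this, h2, h2, add_zero, add_zero]
      exact hs
  have h := Submodule.sub_mem _ (hsum c hac hbc) (hsum d had hbd)
  rw [add_sub_add_right_eq_sub, ZModModule.sub_eq_add] at h
  exact (hnot hcd).2 h

/-! ### Matrices and vector representations -/

theorem cast_rk (M : Matroid α) [M.Finite] (X : Set α) : (rk M X : ℕ∞) = M.eRk X :=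
  ENat.natCast_toNat (Matroid.eRk_ne_top_iff.2 (M.isRkFinite_set X))

theorem rk_eq_ncard_of_isBasis {M : Matroid α} {I X : Set α} (h : M.IsBasis I X) :
    rk M X = I.ncard := by
  rw [rk, ← h.encard_eq_eRk]; rfl

theorem indep_iff_rk_eq_ncard {M : Matroid α} [M.Finite] {I : Set α} (hI : I ⊆ M.E) :
    M.Indep I ↔ rk M I = I.ncard := by
  rw [Matroid.indep_iff_eRk_eq_encard, ← cast_rk, ← (M.ground_finite.subset hI).cast_ncard_eq,
    Nat.cast_inj]

theorem isVectorRep_iff_rk_eq_finrank {K : Type*} [Field K] {M : Matroid α} [M.Finite] {m : ℕ}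
    {v : α → Fin m → K} :
    IsVectorRep K M v ↔ ∀ X ⊆ M.E, rk M X = finrank K (Submodule.span K (v '' X)) := by
  have hcard : ∀ I ⊆ M.E,
      LinearIndepOn K v I ↔ finrank K (Submodule.span K (v '' I)) = I.ncard := by
    intro I hI
    have := (M.ground_finite.subset hI).fintype
    rw [LinearIndepOn, linearIndependent_iff_card_eq_finrank_span, ← Nat.card_eq_fintype_card,
      Nat.card_coe_set_eq, Set.finrank, ← image_eq_range, eq_comm]
  constructor
  · intro h X hX
    obtain ⟨J, hJ⟩ := M.exists_isBasis X hX
    have hJE := hJ.subset.trans hX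
    have hspan : Submodule.span K (v '' X) = Submodule.span K (v '' J) := by
      refine le_antisymm (Submodule.span_le.2 ?_) (Submodule.span_mono (image_mono hJ.subset))
      rintro _ ⟨x, hx, rfl⟩
      by_contra hcon
      have hins := ((h J hJE).1 hJ.indep).notMem_span_iff.1 hcon
      exact hins.2 (hJ.mem_of_insert_indep hx ((h _ (insert_subset (hX hx) hJE)).2 hins.1))
    rw [rk_eq_ncard_of_isBasis hJ, hspan, (hcard J hJE).1 ((h J hJE).1 hJ.indep)]
  · intro h I hI
    rw [indep_iff_rk_eq_ncard hI, h I hI, hcard I hI]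

theorem isRepresentable_iff_exists_isVectorRep {K : Type*} [Field K] {M : Matroid α} [M.Finite] :
    IsRepresentable K M ↔ ∃ (m : ℕ) (v : α → Fin m → K), IsVectorRep K M v := by
  classical
  have hrank : ∀ {m n : ℕ} (G : Matrix (Fin m) (Fin n) K) (ψ : Fin n ≃ M.E) (v : α → Fin m → K),
      (∀ j, v (ψ j) = G.col j) → ∀ X : Finset (Fin n),
      (G.submatrix id (fun j : {j // j ∈ X} => (j : Fin n))).rank =
        finrank K (Submodule.span K (v '' ((fun j => (ψ j : α)) '' (X : Set (Fin n))))) := by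
    intro m n G ψ v hv X
    rw [Matrix.rank_eq_finrank_span_cols, image_image, image_congr (fun j _ => hv j),
      image_eq_range]
    rfl
  constructor
  · rintro ⟨m, n, G, ψ, h⟩
    refine ⟨m, fun x => if hx : x ∈ M.E then G.col (ψ.symm ⟨x, hx⟩) else 0, ?_⟩
    rw [isVectorRep_iff_rk_eq_finrank]
    intro X hX
    have hX' : (fun j => (ψ j : α)) ''
        ((Finset.univ.filter fun j => (ψ j : α) ∈ X : Finset (Fin n)) : Set (Fin n)) = X := by
      ext x
      simp only [Finset.coe_filter, Finset.mem_univ, true_and, mem_image, mem_ofPred_eq]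
      constructor
      · rintro ⟨j, hj, rfl⟩
        exact hj
      · exact fun hx => ⟨ψ.symm ⟨x, hX hx⟩, by simpa using hx, by simp⟩
    rw [← hX', h]
    refine hrank G ψ _ (fun j => ?_) _
    rw [dif_pos (ψ j).2, Subtype.coe_eta, Equiv.symm_apply_apply]
  · rintro ⟨m, v, hv⟩
    rw [isVectorRep_iff_rk_eq_finrank] at hv
    have := M.ground_finite.to_subtype
    obtain ⟨n, ⟨ψ⟩⟩ := Finite.exists_equiv_fin M.E
    refine ⟨m, n, Matrix.of fun i j => v (ψ.symm j) i, ψ.symm, fun X => ?_⟩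
    rw [hrank (Matrix.of fun i j => v (ψ.symm j) i) ψ.symm v (fun j => rfl), hv]
    rintro _ ⟨j, -, rfl⟩
    exact (ψ.symm j).2

/-- Tutte's theorem: a finite matroid is binary exactly when it has no four-point line minor. -/
theorem isBinary_iff_not_hasFourPointLine {M : Matroid α} [M.Finite] :
    IsBinary M ↔ ¬ HasFourPointLine M := by
  rw [IsBinary, isRepresentable_iff_exists_isVectorRep]
  exact ⟨fun ⟨_, _, hv⟩ => hv.not_hasFourPointLine, exists_isVectorRep_of_not_hasFourPointLine⟩

/-! ### The cyclic part of a flat -/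

section CyclicPart

variable {M : Matroid α} {F H X Y I : Set α} {e : α}

theorem cyc_subset : cyc M X ⊆ X := fun _ hx => hx.1

theorem rk_closure : rk M (M.closure X) = rk M X := by
  rw [rk, rk, M.eRk_closure_eq]

variable [M.Finite]

theorem mem_cyc_iff (hX : X ⊆ M.E) : e ∈ cyc M X ↔ e ∈ X ∧ e ∈ M.closure (X \ {e}) :=
  and_congr_right fun he => rk_diff_singleton_iff M hX he

theorem IsCyclicSet.subset_cyc (hY : IsCyclicSet M Y) (hYX : Y ⊆ X) (hX : X ⊆ M.E) :
    Y ⊆ cyc M X := fun e he =>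
  (mem_cyc_iff hX).2 ⟨hYX he, M.closure_subset_closure (sdiff_subset_sdiff_left hYX)
    (((isCyclicSet_iff M).1 hY).2 e he)⟩

/-- The cyclic part of a set is the union of the circuits inside it, hence cyclic. -/
theorem isCyclicSet_cyc (hX : X ⊆ M.E) : IsCyclicSet M (cyc M X) := by
  refine (isCyclicSet_iff M).2 ⟨cyc_subset.trans hX, fun e he => ?_⟩
  obtain ⟨C, hCX, hC, heC⟩ :=
    (M.mem_closure_iff_exists_isCircuit (X := X \ {e}) (e := e) (by simp)).1 ((mem_cyc_iff hX).1 he).2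
  have hCX' : C ⊆ X := fun x hx => by
    rcases hCX hx with rfl | h
    · exact he.1
    · exact h.1
  refine M.closure_subset_closure (sdiff_subset_sdiff_left fun x hx => ?_)
    (hC.mem_closure_sdiff_singleton_of_mem heC)
  exact (mem_cyc_iff hX).2 ⟨hCX' hx, M.closure_subset_closure (sdiff_subset_sdiff_left hCX')
    (hC.mem_closure_sdiff_singleton_of_mem hx)⟩

theorem isCyclicFlat_cyc (hH : M.IsFlat H) : IsCyclicFlat M (cyc M H) := by
  have hHE := hH.subset_ground
  refine ⟨Matroid.isFlat_iff_closure_eq.2 (Subset.antisymm (fun x hx => ?_)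
    (M.subset_closure _ (cyc_subset.trans hHE))), isCyclicSet_cyc hHE⟩
  by_contra hxc
  have hxH : x ∈ H := hH.closure ▸ M.closure_subset_closure cyc_subset hx
  have hsub : cyc M H ⊆ H \ {x} := fun y hy => ⟨cyc_subset hy, by rintro rfl; exact hxc hy⟩
  exact hxc ((mem_cyc_iff hHE).2 ⟨hxH, M.closure_subset_closure hsub hx⟩)

/-- The elements of `X` outside its cyclic part are coloops of the restriction to `X`. -/
theorem union_sdiff_cyc_isBasis (hX : X ⊆ M.E) (hI : M.IsBasis I (cyc M X)) :
    M.IsBasis (I ∪ (X \ cyc M X)) X := by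
  have hcol : X \ cyc M X ⊆ (M.restrict X).coloops := fun e he =>
    (Matroid.restrict_isColoop_iff hX).2 ⟨fun h => he.2 ((mem_cyc_iff hX).2 ⟨he.1, h⟩), he.1⟩
  have hind : (M.restrict X).Indep (I ∪ (X \ cyc M X)) :=
    (Matroid.union_indep_iff_indep_of_subset_coloops hcol).2
      (Matroid.restrict_indep_iff.2 ⟨hI.indep, hI.subset.trans cyc_subset⟩)
  have hind' := Matroid.restrict_indep_iff.1 hind
  refine hind'.1.isBasis_of_subset_of_subset_closure hind'.2 fun x hx => ?_
  by_cases hxc : x ∈ cyc M X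
  · exact M.closure_subset_closure subset_union_left (hI.subset_closure hxc)
  · exact M.mem_closure_of_mem (Or.inr ⟨hx, hxc⟩) hind'.1.subset_ground

theorem rk_eq_rk_cyc_add_ncard (hX : X ⊆ M.E) :
    rk M X = rk M (cyc M X) + (X \ cyc M X).ncard := by
  obtain ⟨I, hI⟩ := M.exists_isBasis (cyc M X) (cyc_subset.trans hX)
  rw [rk_eq_ncard_of_isBasis hI, rk_eq_ncard_of_isBasis (union_sdiff_cyc_isBasis hX hI)]
  exact ncard_union_eq (disjoint_left.2 fun x hx hx' => hx'.2 (hI.subset hx))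
    (M.ground_finite.subset hI.left_subset_ground) (M.ground_finite.subset (sdiff_subset.trans hX))

theorem rk_mono (hXY : X ⊆ Y) : rk M X ≤ rk M Y := by
  have := M.eRk_mono hXY
  rw [← cast_rk, ← cast_rk] at this
  exact_mod_cast this

theorem rk_insert_of_notMem_closure (he : e ∈ M.E \ M.closure X) :
    rk M (insert e X) = rk M X + 1 := by
  have := M.eRk_insert_eq_add_one he
  rw [← cast_rk, ← cast_rk] at this
  exact_mod_cast this

theorem closure_eq_of_subset_of_rk_le (hXY : X ⊆ Y) (h : rk M Y ≤ rk M X) :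
    M.closure X = M.closure Y := by
  refine (M.isRkFinite_set X).closure_eq_closure_of_subset_of_eRk_ge_eRk hXY ?_
  rw [← cast_rk, ← cast_rk]
  exact_mod_cast h

theorem rk_union_le_rk_add_ncard_sdiff (hF : F ⊆ M.E) :
    rk M (X ∪ F) ≤ rk M X + (F \ X).ncard := by
  have := M.eRk_union_le_eRk_add_encard X (F \ X)
  rw [union_sdiff_self, ← cast_rk, ← cast_rk,
    ← (M.ground_finite.subset (sdiff_subset.trans hF)).cast_ncard_eq] at this
  exact_mod_cast this

end CyclicPart

/-! ### Counting the hyperplanes of `M ↾ 1_𝒵` above a flat of corank two -/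

/-- The flats covering `F` that are spanned by `F` and one element of `T \ F`. For `T` the greatest
cyclic flat and `F ⊆ T` of corank two in `T`, these are the hyperplanes of `M ↾ T` containing
`F`. -/
def flatsAbove (M : Matroid α) (T F : Set α) : Set (Set α) :=
  {H | ∃ e ∈ T \ F, M.closure (insert e F) = H}

section Hyperplanes

variable {M : Matroid α} {F H X Y T : Set α} {e x : α}

theorem subset_closure_insert (hF : M.IsFlat F) (he : e ∈ M.E) :
    insert e F ⊆ M.closure (insert e F) :=
  M.subset_closure _ (insert_subset he hF.subset_ground)

/-- Two flats covering `F` with a common element outside `F` coincide. -/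
theorem closure_insert_eq_of_mem (hF : M.IsFlat F) (hx : x ∈ M.closure (insert e F)) (hxF : x ∉ F) :
    M.closure (insert x F) = M.closure (insert e F) :=
  M.closure_insert_congr ⟨hx, by rwa [hF.closure]⟩

variable [M.Finite]

/-- Fibre counting: the number of flats covering `F` is the number of elements outside `F`, less
the redundancy of each of these flats. -/
theorem ncard_sdiff_sub_finsum_flatsAbove (hT : M.IsFlat T) (hF : M.IsFlat F) (hFT : F ⊆ T) :
    ((T \ F).ncard : ℤ) - ∑ᶠ H ∈ {H ∈ flatsAbove M T F | 2 ≤ (H \ F).ncard},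
      (((H \ F).ncard : ℤ) - 1) = (flatsAbove M T F).ncard := by
  classical
  have hTfin : (T \ F).Finite := M.ground_finite.subset (sdiff_subset.trans hT.subset_ground)
  have hfin : (flatsAbove M T F).Finite := hTfin.image _
  have hfiber : ∀ H ∈ flatsAbove M T F,
      (hTfin.toFinset.filter fun x => M.closure (insert x F) = H).card = (H \ F).ncard := by
    rintro _ ⟨e, he, rfl⟩
    rw [← ncard_coe_finset]
    congr 1
    ext x
    simp only [Finset.coe_filter, Finite.mem_toFinset, mem_ofPred_eq, mem_sdiff]
    constructor
    · rintro ⟨⟨hxT, hxF⟩, h⟩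
      exact ⟨h ▸ subset_closure_insert hF (hT.subset_ground hxT) (mem_insert _ _), hxF⟩
    · rintro ⟨hx, hxF⟩
      refine ⟨⟨?_, hxF⟩, closure_insert_eq_of_mem hF hx hxF⟩
      rw [← hT.closure]
      exact M.closure_subset_closure (insert_subset he.1 hFT) hx
  have hpos : ∀ H ∈ flatsAbove M T F, 1 ≤ (H \ F).ncard := by
    rintro _ ⟨e, he, rfl⟩
    refine (ncard_pos (M.ground_finite.subset
      (sdiff_subset.trans (M.closure_subset_ground _)))).2 ⟨e, ?_, he.2⟩
    exact subset_closure_insert hF (hT.subset_ground he.1) (mem_insert _ _)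
  have hsum : ∑ᶠ H ∈ {H ∈ flatsAbove M T F | 2 ≤ (H \ F).ncard}, (((H \ F).ncard : ℤ) - 1) =
      ∑ H ∈ hfin.toFinset, (((H \ F).ncard : ℤ) - 1) := by
    refine finsum_mem_eq_sum_of_inter_support_eq _ ?_
    ext H
    simp only [mem_inter_iff, mem_ofPred_eq, Function.mem_support, Finite.coe_toFinset]
    refine ⟨fun h => ⟨h.1.1, h.2⟩, fun h => ⟨⟨h.1, ?_⟩, h.2⟩⟩
    have := hpos H h.1
    have := h.2
    omega
  have hcount : ((T \ F).ncard : ℤ) = ∑ H ∈ hfin.toFinset, ((H \ F).ncard : ℤ) := by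
    rw [ncard_eq_toFinset_card _ hTfin, Finset.card_eq_sum_card_fiberwise
      (f := fun x => M.closure (insert x F)) (t := hfin.toFinset)
      (fun x hx => by simpa using ⟨x, by simpa using hx, rfl⟩)]
    push_cast
    exact Finset.sum_congr rfl fun H hH => by
      rw [← hfiber H ((Finite.mem_toFinset _).1 hH)]
  rw [hsum, hcount, Finset.sum_sub_distrib, Finset.sum_const, ncard_eq_toFinset_card _ hfin]
  simp

theorem isFlat_topZ : M.IsFlat (topZ M) := (isGreatest_topZ M).1.1

/-- A flat covering `F` with at least two elements outside `F` has all of them in its cyclic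
part. -/
theorem sdiff_subset_cyc (hF : M.IsFlat F) (hH : H ∈ flatsAbove M T F) (hT : T ⊆ M.E)
    (hcard : 2 ≤ (H \ F).ncard) : H \ F ⊆ cyc M H := by
  obtain ⟨e, he, rfl⟩ := hH
  intro x hx
  obtain ⟨y, hy, hyx⟩ := exists_ne_of_one_lt_ncard (Nat.lt_of_succ_le hcard) x
  refine (mem_cyc_iff (M.closure_subset_ground _)).2 ⟨hx.1, ?_⟩
  have hxy : x ∈ M.closure (insert y F) := by
    rw [closure_insert_eq_of_mem hF hy.1 hy.2]
    exact hx.1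
  have hsub : insert y F ⊆ M.closure (insert e F) \ {x} := by
    refine fun z hz => ⟨?_, ?_⟩
    · rcases hz with rfl | hz
      · exact hy.1
      · exact subset_closure_insert hF (hT he.1) (mem_insert_of_mem _ hz)
    · rintro rfl
      rcases hz with h | h
      · exact hyx h.symm
      · exact hx.2 h
  exact M.closure_subset_closure hsub hxy

theorem rk_of_mem_flatsAbove (hF : M.IsFlat F) (hT : T ⊆ M.E) (hH : H ∈ flatsAbove M T F) :
    rk M H = rk M F + 1 := by
  obtain ⟨e, he, rfl⟩ := hH
  rw [rk_closure, rk_insert_of_notMem_closure ⟨hT he.1, by rw [hF.closure]; exact he.2⟩]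

/-- If a flat `H` covering `F` has at least two elements outside `F`, then `H` and `F` have the same
elements outside the cyclic part of `H`, so `ρ(H)` is computed by the defining equation of
`upsilon M F`. -/
theorem cyc_mem_upsilon (hF : M.IsFlat F) (hrk : rk M F + 2 = rk M (topZ M))
    (hH : H ∈ flatsAbove M (topZ M) F) (hcard : 2 ≤ (H \ F).ncard) : cyc M H ∈ upsilon M F := by
  have hTE := (isFlat_topZ (M := M)).subset_ground
  have hsub := sdiff_subset_cyc hF hH hTE hcard
  have hr := rk_of_mem_flatsAbove hF hTE hH
  obtain ⟨e, he, rfl⟩ := hH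
  set H := M.closure (insert e F)
  have hHE : H ⊆ M.E := M.closure_subset_ground _
  have hFH : F ⊆ H := (subset_insert _ _).trans (subset_closure_insert hF (hTE he.1))
  refine ⟨isCyclicFlat_cyc (M.isFlat_closure _), ?_⟩
  have hdiff : H \ cyc M H = F \ cyc M H := by
    ext x
    refine ⟨fun hx => ⟨?_, hx.2⟩, fun hx => ⟨hFH hx.1, hx.2⟩⟩
    by_contra hxF
    exact hx.2 (hsub ⟨hx.1, hxF⟩)
  have h := rk_eq_rk_cyc_add_ncard hHE
  rw [hdiff] at h
  omega

/-- The members of `upsilonMax M F` are the cyclic parts of the flats that cover `F` and have at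
least two elements outside it. -/
theorem upsilonMax_eq_image_cyc (hF : M.IsFlat F) (hrk : rk M F + 2 = rk M (topZ M)) :
    upsilonMax M F = cyc M '' {H ∈ flatsAbove M (topZ M) F | 2 ≤ (H \ F).ncard} := by
  have hTE := (isFlat_topZ (M := M)).subset_ground
  -- A member of `upsilon M F` containing an element of `H \ F` spans, with `F`, exactly `H`.
  have hsubH : ∀ H ∈ flatsAbove M (topZ M) F, ∀ Y ∈ upsilon M F, ∀ e ∈ Y, e ∈ H \ F → Y ⊆ H := by
    intro H hH Y hY e heY heH
    have hr := rk_of_mem_flatsAbove hF hTE hH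
    obtain ⟨f, hf, rfl⟩ := hH
    have heq := closure_insert_eq_of_mem hF heH.1 heH.2
    have hYE := hY.1.1.subset_ground
    have hle := rk_union_le_rk_add_ncard_sdiff (M := M) (X := Y) hF.subset_ground
    have hYr := hY.2
    rw [← heq, rk_closure] at hr
    rw [← heq, closure_eq_of_subset_of_rk_le (Y := Y ∪ F)
      (insert_subset (Or.inl heY) subset_union_right) (by omega)]
    exact subset_union_left.trans (M.subset_closure _ (union_subset hYE hF.subset_ground))
  ext X
  constructor
  · rintro ⟨hX, hXF⟩
    obtain ⟨e, heX, heF⟩ := not_subset.1 hXF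
    have hXT : X ⊆ topZ M := (isGreatest_topZ M).2 hX.prop.1
    have hH : M.closure (insert e F) ∈ flatsAbove M (topZ M) F := ⟨e, ⟨hXT heX, heF⟩, rfl⟩
    set H := M.closure (insert e F) with hHdef
    have heH : e ∈ H := subset_closure_insert hF (hTE (hXT heX)) (mem_insert _ _)
    have hXH : X ⊆ H := hsubH H hH X hX.prop e heX ⟨heH, heF⟩
    have hHE : H ⊆ M.E := M.closure_subset_ground _
    have hXcyc : X ⊆ cyc M H := hX.prop.1.2.subset_cyc hXH hHE
    have hcard : 2 ≤ (H \ F).ncard := by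
      by_contra hlt
      -- Otherwise `e` would be a coloop of `H`, although it lies in the cyclic set `X ⊆ H`.
      have hone : H \ F ⊆ {e} := by
        intro x hx
        by_contra hxe
        exact hlt ((one_lt_ncard (M.ground_finite.subset (sdiff_subset.trans hHE))).2
          ⟨x, hx, e, ⟨heH, heF⟩, hxe⟩)
      have hsub : H \ {e} ⊆ F := fun x hx => by
        by_contra hxF
        exact hx.2 (hone ⟨hx.1, hxF⟩)
      exact heF (hF.closure ▸ M.closure_subset_closure hsub ((mem_cyc_iff hHE).1 (hXcyc heX)).2)
    exact ⟨H, ⟨hH, hcard⟩, (hX.eq_of_subset (cyc_mem_upsilon hF hrk hH hcard) hXcyc).symm⟩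
  · rintro ⟨H, ⟨hH, hcard⟩, rfl⟩
    have hsub := sdiff_subset_cyc hF hH hTE hcard
    obtain ⟨e, he⟩ : (H \ F).Nonempty := nonempty_of_ncard_ne_zero (by omega)
    have hHE : H ⊆ M.E := by
      obtain ⟨f, -, rfl⟩ := hH
      exact M.closure_subset_ground _
    refine ⟨⟨cyc_mem_upsilon hF hrk hH hcard, fun Y hY hHY => ?_⟩, fun h => he.2 (h (hsub he))⟩
    exact hY.1.2.subset_cyc (hsubH H hH Y hY e (hHY (hsub he)) he) hHE

theorem ncard_sdiff_sub_finsum_upsilonMax (hF : M.IsFlat F) (hFT : F ⊆ topZ M)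
    (hrk : rk M F + 2 = rk M (topZ M)) :
    ((topZ M \ F).ncard : ℤ) - ∑ᶠ X ∈ upsilonMax M F, (((X \ F).ncard : ℤ) - 1) =
      (flatsAbove M (topZ M) F).ncard := by
  have hTE := (isFlat_topZ (M := M)).subset_ground
  have hdiff : ∀ H ∈ {H ∈ flatsAbove M (topZ M) F | 2 ≤ (H \ F).ncard}, cyc M H \ F = H \ F :=
    fun H hH => Subset.antisymm (sdiff_subset_sdiff_left cyc_subset)
      fun x hx => ⟨sdiff_subset_cyc hF hH.1 hTE hH.2 hx, hx.2⟩
  have hFH : ∀ H ∈ flatsAbove M (topZ M) F, F ⊆ H := by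
    rintro _ ⟨e, he, rfl⟩
    exact (subset_insert _ _).trans (subset_closure_insert hF (hTE he.1))
  have hinj : InjOn (cyc M) {H ∈ flatsAbove M (topZ M) F | 2 ≤ (H \ F).ncard} := by
    intro H hH H' hH' heq
    have : H \ F = H' \ F := by rw [← hdiff H hH, ← hdiff H' hH', heq]
    rw [← sdiff_union_of_subset (hFH H hH.1), this, sdiff_union_of_subset (hFH H' hH'.1)]
  rw [upsilonMax_eq_image_cyc hF hrk, finsum_mem_image hinj,
    finsum_mem_congr rfl (fun H hH => by rw [hdiff H hH]),
    ncard_sdiff_sub_finsum_flatsAbove isFlat_topZ hF hFT]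

/-- Together with all coloops, a basis of the greatest cyclic flat is a base. -/
theorem isBase_union_coloops {I : Set α} (hI : M.IsBasis I (topZ M)) :
    M.IsBase (I ∪ M.coloops) := by
  have h := union_sdiff_cyc_isBasis subset_rfl hI
  have hc : M.E \ cyc M M.E = M.coloops := by
    rw [show cyc M M.E = topZ M from rfl, topZ_eq, sdiff_sdiff_right_self]
    exact inter_eq_right.2 M.coloops_subset_ground
  rwa [hc, Matroid.isBasis_ground_iff] at h

/-- Four distinct covers of `F` give a four-point line: complete a basis of `F` by the coloops and
take one element from each cover. -/
theorem hasFourPointLine_of_four_le_ncard_flatsAbove (hF : M.IsFlat F) (hFT : F ⊆ topZ M)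
    (hrk : rk M F + 2 = rk M (topZ M)) (h4 : 4 ≤ (flatsAbove M (topZ M) F).ncard) :
    HasFourPointLine M := by
  have hTE := (isFlat_topZ (M := M)).subset_ground
  obtain ⟨I, hI⟩ := M.exists_isBasis F hF.subset_ground
  have hIF : M.closure I = F := by rw [hI.closure_eq_closure, hF.closure]
  have hpair : ∀ x ∈ topZ M \ F, ∀ y ∈ topZ M \ F,
      M.closure (insert x F) ≠ M.closure (insert y F) → IsBasePair M (I ∪ M.coloops) x y := by
    intro x hx y hy hxy
    have hne : x ≠ y := by rintro rfl; exact hxy rfl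
    have hcol : ∀ z ∈ topZ M, z ∉ M.coloops := fun z hz => by
      rw [topZ_eq] at hz; exact hz.2
    have hnI : ∀ z ∈ topZ M \ F, z ∉ I ∪ M.coloops := by
      rintro z hz (h | h)
      · exact hz.2 (hI.subset h)
      · exact hcol z hz.1 h
    refine ⟨hne, hnI x hx, hnI y hy, ?_⟩
    have hyI : M.Indep (insert y I) := hI.indep.insert_indep_iff.2
      (Or.inl ⟨hTE hy.1, by rw [hIF]; exact hy.2⟩)
    have hxyI : M.Indep (insert x (insert y I)) := by
      refine hyI.insert_indep_iff.2 (Or.inl ⟨hTE hx.1, fun h => hxy ?_⟩)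
      rw [← M.closure_insert_closure_eq_closure_insert, hIF] at h
      exact closure_insert_eq_of_mem hF h hx.2
    have hsub : insert x (insert y I) ⊆ topZ M :=
      insert_subset hx.1 (insert_subset hy.1 (hI.subset.trans hFT))
    have hIfin : I.Finite := hI.indep.finite
    have hbasis : M.IsBasis (insert x (insert y I)) (topZ M) := by
      refine hxyI.isBasis_of_eRk_ge hxyI.finite hsub ?_ hTE
      rw [hxyI.eRk_eq_encard, ← cast_rk, ← hxyI.finite.cast_ncard_eq, ← hrk,
        rk_eq_ncard_of_isBasis hI,
        ncard_insert_of_notMem (fun h => h.elim hne fun h => hx.2 (hI.subset h)) (hIfin.insert _),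
        ncard_insert_of_notMem (fun h => hy.2 (hI.subset h)) hIfin]
    rw [← insert_union, ← insert_union]
    exact isBase_union_coloops hbasis
  have hfin : (flatsAbove M (topZ M) F).Finite :=
    (M.ground_finite.subset (sdiff_subset.trans hTE)).image _
  obtain ⟨_, ⟨a, ha, rfl⟩, _, ⟨b, hb, rfl⟩, _, ⟨c, hc, rfl⟩, _, ⟨d, hd, rfl⟩, hab, hac, had, hbc,
    hbd, hcd⟩ := (three_lt_ncard hfin).1 (Nat.lt_of_succ_le h4)
  exact ⟨_, a, b, c, d, hpair a ha b hb hab, hpair a ha c hc hac, hpair a ha d hd had,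
    hpair b hb c hc hbc, hpair b hb d hd hbd, hpair c hc d hd hcd⟩

/-- A four-point line gives a flat of corank two with four covers: its common part `I` contains
all coloops, and the closure of the rest of `I` is such a flat. -/
theorem HasFourPointLine.exists_four_le_ncard_flatsAbove (h : HasFourPointLine M) :
    ∃ F, M.IsFlat F ∧ F ⊆ topZ M ∧ rk M F + 2 = rk M (topZ M) ∧
      4 ≤ (flatsAbove M (topZ M) F).ncard := by
  obtain ⟨I, a, b, c, d, hab, hac, had, hbc, hbd, hcd⟩ := h
  have hTE := (isFlat_topZ (M := M)).subset_ground
  -- Each of the four elements is missed by the base formed from two of the others, so it is not a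
  -- coloop.
  have hmem : ∀ {x y z}, IsBasePair M I x y → IsBasePair M I y z → x ≠ z → x ∈ topZ M := by
    intro x y z hxy hyz hxz
    rw [topZ_eq]
    refine ⟨hxy.2.2.2.subset_ground (by simp), fun hcol => ?_⟩
    rcases Matroid.IsColoop.mem_of_isBase hcol hyz.2.2.2 with h | h | h
    · exact hxy.1 h
    · exact hxz h
    · exact hxy.2.1 h
  have ha := hmem hab hbc hac.1
  have hb := hmem hbc hcd hbd.1
  have hc := hmem hcd had.symm hac.1.symm
  have hd := hmem had.symm hab hbd.1.symm
  have hIc : M.coloops ⊆ I := by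
    intro x hx
    have hxT : x ∉ topZ M := by rw [topZ_eq]; exact fun h => h.2 hx
    rcases hab.2.2.2.coloops_subset hx with rfl | rfl | h
    · exact absurd ha hxT
    · exact absurd hb hxT
    · exact h
  have hIE : I ⊆ M.E := fun x hx => hab.2.2.2.subset_ground (by simp [hx])
  set J := I \ M.coloops with hJ
  have hJT : J ⊆ topZ M := by rw [topZ_eq]; exact sdiff_subset_sdiff_left hIE
  have hJind : M.Indep J := hab.2.2.2.indep.subset
    (sdiff_subset.trans ((subset_insert _ _).trans (subset_insert _ _)))
  have hindep : ∀ {x y}, IsBasePair M I x y → M.Indep (insert x (insert y J)) := by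
    intro x y hxy
    exact hxy.2.2.2.indep.subset (insert_subset_insert (insert_subset_insert sdiff_subset))
  have hnotJ : ∀ {x}, x ∉ I → x ∉ J := fun hx h => hx h.1
  have hcl : ∀ {x y}, IsBasePair M I x y → x ∈ topZ M → x ∉ M.closure (insert y J) := by
    intro x y hxy hx
    have hind := hindep hxy
    have hyJ : M.Indep (insert y J) := hind.subset (subset_insert _ _)
    exact (hyJ.notMem_closure_iff_of_notMem
      (fun h => h.elim hxy.1 (hnotJ hxy.2.1)) (hTE hx)).2 hind
  have hF : M.IsFlat (M.closure J) := M.isFlat_closure J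
  have hclJ : ∀ {x y}, IsBasePair M I x y → x ∈ topZ M →
      M.closure (insert x (M.closure J)) ≠ M.closure (insert y (M.closure J)) := by
    intro x y hxy hx heq
    refine hcl hxy hx ?_
    rw [← M.closure_insert_closure_eq_closure_insert y J, ← heq]
    exact subset_closure_insert hF (hTE hx) (mem_insert _ _)
  have hnF : ∀ {x y}, IsBasePair M I x y → x ∈ topZ M → x ∉ M.closure J :=
    fun hxy hx h => hcl hxy hx (M.closure_subset_closure (subset_insert _ _) h)
  have hFT : M.closure J ⊆ topZ M := by
    rw [← (isFlat_topZ (M := M)).closure]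
    exact M.closure_subset_closure hJT
  refine ⟨M.closure J, hF, hFT, ?_, ?_⟩
  · have hB : M.IsBasis (insert a (insert b J)) (topZ M) := by
      refine (hindep hab).isBasis_of_subset_of_subset_closure
        (insert_subset ha (insert_subset hb hJT)) fun x hx => ?_
      have hxE := hTE hx
      rw [← hab.2.2.2.closure_eq] at hxE
      have heq : insert a (insert b I) = insert a (insert b J) ∪ M.coloops := by
        rw [insert_union, insert_union, hJ, sdiff_union_of_subset hIc]
      rw [heq, Matroid.closure_union_eq_of_subset_coloops _ subset_rfl] at hxE
      rw [topZ_eq] at hx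
      exact hxE.resolve_right hx.2
    rw [rk_closure, rk_eq_ncard_of_isBasis hB, rk_eq_ncard_of_isBasis hJind.isBasis_self,
      ncard_insert_of_notMem (fun h => h.elim hab.1 (hnotJ hab.2.1)) (hJind.finite.insert _),
      ncard_insert_of_notMem (hnotJ hab.2.2.1) hJind.finite]
  · have hfin : (flatsAbove M (topZ M) (M.closure J)).Finite :=
      (M.ground_finite.subset (sdiff_subset.trans hTE)).image _
    let φ : α → Set α := fun x => M.closure (insert x (M.closure J))
    have hsub : ({φ a, φ b, φ c, φ d} : Set (Set α)) ⊆ flatsAbove M (topZ M) (M.closure J) := by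
      rintro _ (rfl | rfl | rfl | rfl)
      · exact ⟨a, ⟨ha, hnF hab ha⟩, rfl⟩
      · exact ⟨b, ⟨hb, hnF hbc hb⟩, rfl⟩
      · exact ⟨c, ⟨hc, hnF hcd hc⟩, rfl⟩
      · exact ⟨d, ⟨hd, hnF had.symm hd⟩, rfl⟩
    refine le_trans (le_of_eq ?_) (ncard_le_ncard hsub hfin)
    rw [ncard_insert_of_notMem, ncard_insert_of_notMem, ncard_pair (hclJ hcd hc)]
    · rintro (h | h)
      · exact hclJ hbc hb h
      · exact hclJ hbd hb h
    · rintro (h | h | h)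
      · exact hclJ hab ha h
      · exact hclJ hac ha h
      · exact hclJ had ha h

end Hyperplanes

/-- The condition on flats of corank two in the greatest cyclic flat excludes four-point lines. -/
theorem forall_flat_lt_four_iff {M : Matroid α} [M.Finite] :
    (∀ F : Set α, M.IsFlat F → F ⊆ topZ M → (rk M F : ℤ) = (rk M (topZ M) : ℤ) - 2 →
        ((topZ M \ F).ncard : ℤ) - ∑ᶠ X ∈ upsilonMax M F, (((X \ F).ncard : ℤ) - 1) < 4) ↔
      ¬ HasFourPointLine M := by
  constructor
  · intro h hM
    obtain ⟨F, hF, hFT, hrk, h4⟩ := hM.exists_four_le_ncard_flatsAbove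
    have := h F hF hFT (by omega)
    rw [ncard_sdiff_sub_finsum_upsilonMax hF hFT hrk] at this
    omega
  · intro hM F hF hFT hrk
    have hrk' : rk M F + 2 = rk M (topZ M) := by omega
    rw [ncard_sdiff_sub_finsum_upsilonMax hF hFT hrk']
    by_contra hlt
    exact hM (hasFourPointLine_of_four_le_ncard_flatsAbove hF hFT hrk' (by omega))

/-! ### Duality by complementation -/

section Duality

variable {M : Matroid α} [M.Finite] {F U X : Set α}

theorem rk_dual_compl_add_rk_ground (hX : X ⊆ M.E) :
    rk M✶ (M.E \ X) + rk M M.E = rk M X + (M.E \ X).ncard := by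
  have h := M.eRk_dual_add_eRank (M.E \ X)
  rw [sdiff_sdiff_eq_self hX, ← M.eRk_ground, ← cast_rk, ← cast_rk, ← cast_rk,
    ← M.ground_finite.sdiff.cast_ncard_eq] at h
  exact_mod_cast h

theorem isFlat_iff_rk_insert_ne (hF : F ⊆ M.E) :
    M.IsFlat F ↔ ∀ e ∈ M.E \ F, rk M (insert e F) ≠ rk M F := by
  constructor
  · intro h e he
    rw [rk_insert_of_notMem_closure ⟨he.1, by rw [h.closure]; exact he.2⟩]
    omega
  · intro h
    refine Matroid.isFlat_iff_closure_eq.2 (Subset.antisymm (fun e he => ?_)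
      (M.subset_closure F hF))
    by_contra heF
    refine h e ⟨M.closure_subset_ground _ he, heF⟩ ?_
    rw [← rk_closure, M.closure_insert_eq_of_mem_closure he, rk_closure]

theorem isFlat_dual_compl_iff (hU : U ⊆ M.E) : M✶.IsFlat (M.E \ U) ↔ IsCyclicSet M U := by
  have hcyc : IsCyclicSet M U ↔ ∀ e ∈ U, rk M (U \ {e}) = rk M U :=
    ⟨fun h e he => (h.2.symm.subset he).2, fun h => ⟨hU, sep_eq_self_iff_mem_true.2 h⟩⟩
  rw [isFlat_iff_rk_insert_ne (M := M✶) (F := M.E \ U) sdiff_subset, Matroid.dual_ground,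
    sdiff_sdiff_eq_self hU, hcyc]
  refine forall₂_congr fun e he => ?_
  have hset : insert e (M.E \ U) = M.E \ (U \ {e}) := by
    ext x; simp only [mem_insert_iff, mem_sdiff, mem_singleton_iff]
    by_cases hx : x = e
    · subst hx; simp [hU he]
    · simp [hx]
  have h1 := rk_dual_compl_add_rk_ground hU
  have h2 := rk_dual_compl_add_rk_ground (M := M) (X := U \ {e}) (sdiff_subset.trans hU)
  have h3 : (M.E \ (U \ {e})).ncard = (M.E \ U).ncard + 1 := by
    rw [← hset, ncard_insert_of_notMem (fun h => h.2 he) M.ground_finite.sdiff]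
  have h4 : rk M U ≤ rk M (U \ {e}) + 1 := by
    have := M.eRk_insert_le_add_one e (U \ {e})
    rw [insert_sdiff_self_of_mem he, ← cast_rk, ← cast_rk] at this
    exact_mod_cast this
  have h5 : rk M (U \ {e}) ≤ rk M U := rk_mono sdiff_subset
  rw [hset]
  omega

theorem isCyclicFlat_dual_compl_iff (hX : X ⊆ M.E) :
    IsCyclicFlat M✶ (M.E \ X) ↔ IsCyclicFlat M X := by
  have h := isFlat_dual_compl_iff (M := M✶) (U := M.E \ X) sdiff_subset
  rw [Matroid.dual_dual, Matroid.dual_ground, sdiff_sdiff_eq_self hX] at h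
  rw [IsCyclicFlat, IsCyclicFlat, isFlat_dual_compl_iff hX, h, and_comm]

theorem topZ_dual : topZ M✶ = M.E \ botZ M := by
  rw [topZ_eq, Matroid.dual_ground, Matroid.dual_coloops]
  rfl

theorem rk_topZ_dual_add_rk_ground :
    rk M✶ (topZ M✶) + rk M M.E + (botZ M).ncard = M.E.ncard := by
  have hE : botZ M ⊆ M.E := M.closure_subset_ground _
  have h := rk_dual_compl_add_rk_ground hE
  have h0 : rk M (botZ M) = 0 := by
    rw [botZ, rk_closure, rk, M.eRk_empty]; rfl
  have := ncard_sdiff_add_ncard_of_subset hE M.ground_finite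
  rw [topZ_dual]
  omega

theorem compl_mem_upsilon_dual_iff (hX : X ⊆ M.E) :
    M.E \ X ∈ upsilon M✶ (M.E \ U) ↔ X ∈ upsilonDual M U := by
  refine and_congr (isCyclicFlat_dual_compl_iff hX) ?_
  have hset : (M.E \ U) \ (M.E \ X) = X \ U := by
    ext x; have := @hX x; simp only [mem_sdiff]; tauto
  have h1 := rk_dual_compl_add_rk_ground hX
  have h2 := rk_topZ_dual_add_rk_ground (M := M)
  have h3 := ncard_sdiff_add_ncard_of_subset hX M.ground_finite
  have h4 := ncard_inter_add_ncard_sdiff_eq_ncard X U (M.ground_finite.subset hX)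
  rw [hset]
  omega

theorem compl_mem_upsilonMax_dual_iff (hU : U ⊆ M.E) (hX : X ⊆ M.E) :
    M.E \ X ∈ upsilonMax M✶ (M.E \ U) ↔ X ∈ upsilonDualMin M U := by
  have hcontained : ∀ {Y Z : Set α}, Y ⊆ M.E → (M.E \ Z ⊆ M.E \ Y ↔ Y ⊆ Z) := fun hY =>
    ⟨fun h x hx => by_contra fun hZ => (h ⟨hY hx, hZ⟩).2 hx, fun h => sdiff_subset_sdiff_right h⟩
  refine and_congr ⟨fun h => ⟨(compl_mem_upsilon_dual_iff hX).1 h.prop, fun Z hZ hZX => ?_⟩,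
    fun h => ⟨(compl_mem_upsilon_dual_iff hX).2 h.prop, fun Y hY hXY => ?_⟩⟩
    (not_congr (hcontained hU))
  · have hZE := hZ.1.1.subset_ground
    exact (hcontained hX).1 (h.le_of_ge ((compl_mem_upsilon_dual_iff hZE).2 hZ)
      ((hcontained hZE).2 hZX))
  · have hYE : Y ⊆ M.E := hY.1.1.subset_ground
    rw [← sdiff_sdiff_eq_self hYE] at hY hXY ⊢
    have hmem := (compl_mem_upsilon_dual_iff sdiff_subset).1 hY
    exact (hcontained hX).2 (h.le_of_le hmem ((hcontained sdiff_subset).1 hXY))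

theorem upsilonMax_dual_compl (hU : U ⊆ M.E) :
    upsilonMax M✶ (M.E \ U) = (fun X => M.E \ X) '' upsilonDualMin M U := by
  ext Y
  constructor
  · intro hY
    have hYE : Y ⊆ M.E := hY.1.prop.1.1.subset_ground
    refine ⟨M.E \ Y, (compl_mem_upsilonMax_dual_iff hU sdiff_subset).1 ?_,
      sdiff_sdiff_eq_self hYE⟩
    rwa [sdiff_sdiff_eq_self hYE]
  · rintro ⟨X, hX, rfl⟩
    exact (compl_mem_upsilonMax_dual_iff hU hX.1.prop.1.1.subset_ground).2 hX

theorem finsum_upsilonMax_dual_compl (hU : U ⊆ M.E) :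
    ∑ᶠ X ∈ upsilonMax M✶ (M.E \ U), (((X \ (M.E \ U)).ncard : ℤ) - 1) =
      ∑ᶠ X ∈ upsilonDualMin M U, (((U \ X).ncard : ℤ) - 1) := by
  have hE : ∀ X ∈ upsilonDualMin M U, X ⊆ M.E := fun X hX => hX.1.prop.1.1.subset_ground
  rw [upsilonMax_dual_compl hU, finsum_mem_image]
  · refine finsum_mem_congr rfl fun X hX => ?_
    have : (M.E \ X) \ (M.E \ U) = U \ X := by
      ext x; have := @hU x; simp only [mem_sdiff]; tauto
    rw [this]
  · intro X hX Y hY h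
    rw [← sdiff_sdiff_eq_self (hE X hX), ← sdiff_sdiff_eq_self (hE Y hY)]
    exact congrArg (M.E \ ·) h

theorem forall_cyclicSet_lt_four_iff :
    (∀ U : Set α, IsCyclicSet M U → botZ M ⊆ U → nullity M U = ((botZ M).ncard : ℤ) + 2 →
        ((U \ botZ M).ncard : ℤ)
          - ∑ᶠ X ∈ upsilonDualMin M U, (((U \ X).ncard : ℤ) - 1) < 4) ↔
      ∀ F : Set α, M✶.IsFlat F → F ⊆ topZ M✶ → (rk M✶ F : ℤ) = (rk M✶ (topZ M✶) : ℤ) - 2 →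
        ((topZ M✶ \ F).ncard : ℤ)
          - ∑ᶠ X ∈ upsilonMax M✶ F, (((X \ F).ncard : ℤ) - 1) < 4 := by
  have key : ∀ U ⊆ M.E, (M.E \ U ⊆ topZ M✶ ↔ botZ M ⊆ U) ∧
      ((rk M✶ (M.E \ U) : ℤ) = (rk M✶ (topZ M✶) : ℤ) - 2 ↔
        nullity M U = ((botZ M).ncard : ℤ) + 2) ∧ topZ M✶ \ (M.E \ U) = U \ botZ M := by
    intro U hU
    have hbot : botZ M ⊆ M.E := M.closure_subset_ground _
    refine ⟨?_, ?_, ?_⟩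
    · rw [topZ_dual]
      exact ⟨fun h x hx => by_contra fun hxU => (h ⟨hbot hx, hxU⟩).2 hx,
        fun h => sdiff_subset_sdiff_right h⟩
    · have h1 := rk_dual_compl_add_rk_ground hU
      have h2 := rk_topZ_dual_add_rk_ground (M := M)
      have h3 := ncard_sdiff_add_ncard_of_subset hU M.ground_finite
      rw [nullity]
      omega
    · rw [topZ_dual]
      ext x; have := @hU x; simp only [mem_sdiff]; tauto
  constructor
  · intro h F hF hFT hrk
    obtain ⟨U, hU, rfl⟩ : ∃ U ⊆ M.E, M.E \ U = F :=
      ⟨M.E \ F, sdiff_subset, sdiff_sdiff_eq_self hF.subset_ground⟩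
    obtain ⟨h1, h2, h3⟩ := key U hU
    rw [h3, finsum_upsilonMax_dual_compl hU]
    exact h U ((isFlat_dual_compl_iff hU).1 hF) (h1.1 hFT) (h2.1 hrk)
  · intro h U hU hbot hnull
    obtain ⟨h1, h2, h3⟩ := key U hU.1
    have := h (M.E \ U) ((isFlat_dual_compl_iff hU.1).2 hU) (h1.2 hbot) (h2.2 hnull)
    rwa [h3, finsum_upsilonMax_dual_compl hU.1] at this

end Duality

end CyclicFlats

theorem mainTheorem3 {α : Type*} (M : Matroid α) [M.Finite] :
    List.TFAE [
      IsBinary M,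
      ∀ F : Set α, M.IsFlat F → F ⊆ topZ M → (rk M F : ℤ) = (rk M (topZ M) : ℤ) - 2 →
        ((topZ M \ F).ncard : ℤ)
          - ∑ᶠ X ∈ upsilonMax M F, (((X \ F).ncard : ℤ) - 1) < 4,
      ∀ U : Set α, IsCyclicSet M U → botZ M ⊆ U →
        nullity M U = ((botZ M).ncard : ℤ) + 2 →
        ((U \ botZ M).ncard : ℤ)
          - ∑ᶠ X ∈ upsilonDualMin M U, (((U \ X).ncard : ℤ) - 1) < 4] := by
  tfae_have 1 ↔ 2 := isBinary_iff_not_hasFourPointLine.trans forall_flat_lt_four_iff.symm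
  tfae_have 1 ↔ 3 := by
    rw [forall_cyclicSet_lt_four_iff, forall_flat_lt_four_iff, hasFourPointLine_dual_iff]
    exact isBinary_iff_not_hasFourPointLine
  tfae_finish
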